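/- Let $n\ge 2$. On $\mathbb{C}^{n+1}$ let $((z,w))=-z_0\bar w_0+\sum_{k=1}^n z_k\bar w_k$ and $\langle z,w\rangle=\operatorname{Re}((z,w))$. Let $H_1^{2n+1}=\{w:((w,w))=-1\}$ and let $\pi_-:H_1^{2n+1}\to\mathbb{CH}^n=H_1^{2n+1}/S^1$ be the Hopf fibration onto complex hyperbolic space of constant holomorphic sectional curvature $-4$, with its complex structure $J$, metric and Levi-Civita connection $\bar\nabla$. Let $$M_V=\{(u_-,u_+)\in(\mathbb{C}^{n+1})^2:\ ((u_-,u_-))=-1,\ ((u_+,u_+))=1,\ ((u_-,u_+))=0\},\qquad M_S=M_V/S^1,$$ where $e^{i\theta}$ acts by $(u_-,u_+)\mapsto(e^{i\theta}u_-,e^{i\theta}u_+)$. For $s\in\{+,-,0\}$ let the twistor space $M_Z^s$ be the quotient of $M_S$ by the action $(u_-,u_+)\mapsto(u_-,u_+)g^s_t$, $t\in\mathbb{R}$, of the one-parameter group $$g^+_t=\begin{pmatrix}e^{it}&0\\0&e^{-it}\end{pmatrix},\quad g^-_t=\begin{pmatrix}\cosh t&\sinh t\\ \sinh t&\cosh t\end{pmatrix},\quad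 g^0_t=\begin{pmatrix}1+it&t\\t&1-it\end{pmatrix}.$$ The twistor fibration is the projection of $M_Z^s$ onto the Grassmannian $\mathbb{G}_{1,1}(\mathbb{C}_1^{n+1})$ of complex $2$-planes of signature $(1,1)$, induced by $(u_-,u_+)\mapsto\operatorname{span}_{\mathbb{C}}\{u_-,u_+\}$. Its horizontal spaces are the images of the spaces $\{u_-,u_+\}^\perp\times\{u_-,u_+\}^\perp\subset T_{(u_-,u_+)}M_V$ under the differential of $M_V\to M_Z^s$; a map into $M_Z^s$ is horizontal if its differential takes values in them. Let $\Sigma$ be a smooth manifold of real dimension $2n-2$ and $\varphi_s:\Sigma\to M_Z^s$ a smooth immersion that is horizontal with respect to the twistor fibration. Let $\Sigma_S=\varphi_s^*M_S$ be the pull-back of the bundle $M_S\to M_Z^s$, and for $r\in\mathbb{R}$ let $$\Phi_r^s:\Sigma_S\to\mathbb{CH}^n,\qquad \Phi^s_r(p,[u_-,u_+])=\begin{cases}\pi_-(\cosh r\,u_-+\sinh r\,u_+)&(s=+),\\ \pi_-(\cosh r\,u_-+i\sinh r\,u_+)&(s=-,0).\end{cases}$$ Fix $r\in\mathbb{R}$,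 with $r\neq0$ if $s=+$, and assume that $\Phi_r^s$ is an immersion. A hypersurface with unit normal $N$, shape operator $AX=-\bar\nabla_XN$ and structure vector $\xi=-JN$ is called Hopf, with Hopf curvature $\mu$, if $A\xi=\mu\xi$. Then there are maps $N_{r'}:\Sigma_S\to T\mathbb{CH}^n$ ($r'\in\mathbb{R}$) such that the following hold. 1. $\Phi_r^s$ is a real hypersurface with the smooth unit normal field $N_r$, and it is Hopf with constant Hopf curvature $\mu$, where $|\mu|>2$ if $s=+$, $|\mu|<2$ if $s=-$, and $|\mu|=2$ if $s=0$. 2. The maps $\Phi^s_{r'}$, $r'\in\mathbb{R}$, form a parallel family of Hopf hypersurfaces, possibly with focal points: - for each $y\in\Sigma_S$ the curve $r'\mapsto\Phi^s_{r'}(y)$ is a geodesic of $\mathbb{CH}^n$ with velocity $N_{r'}(y)$, so that $\Phi^s_{r'}(y)=\exp((r'-r)N_r(y))$; - for each $r'$, $N_{r'}$ is a smooth field of unit vectors along $\Phi^s_{r'}$ orthogonal to the image of $d\Phi^s_{r'}$; - for each $r'$ there is a constant $\mu_{r'}$, with $|\mu_{r'}|>2$, $<2$ or $=2$ for $s=+$,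 $-$ or $0$ respectively, such that $\Phi^s_{r'}$ is Hopf with respect to $N_{r'}$ with Hopf curvature $\mu_{r'}$ at all points where it is an immersion; - $\Phi^s_{r'}$ fails to be an immersion at $y$ if and only if $(r'-r,y)$ is a critical point of the normal exponential map $(\tau,y)\mapsto\exp(\tau N_r(y))=\Phi^s_{r+\tau}(y)$ of $\Phi_r^s$, that is, gives a focal point of $\Phi_r^s$. -/

import Mathlib

open scoped Manifold ContDiff Topology

noncomputable section

namespace HopfTwistor

/-! ### The Hermitian space of signature `(1, n)` -/

/-- The vector space `ℂ₁ⁿ⁺¹`. -/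
abbrev V (n : ℕ) : Type := Fin (n + 1) → ℂ

/-- The Hermitian form `((z, w)) = -z₀ w̄₀ + ∑ zₖ w̄ₖ`. -/
def herm {n : ℕ} (z w : V n) : ℂ :=
  -(z 0 * star (w 0)) + ∑ k : Fin n, z k.succ * star (w k.succ)

/-- The scalar product `⟨z, w⟩ = Re ((z, w))`. -/
def sp {n : ℕ} (z w : V n) : ℝ := (herm z w).re

section hermLemmas

variable {n : ℕ}

theorem herm_add_left (x y z : V n) : herm (x + y) z = herm x z + herm y z := by
  simp only [herm, Pi.add_apply, add_mul, Finset.sum_add_distrib]; ring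

theorem herm_smul_left (c : ℂ) (x z : V n) : herm (c • x) z = c * herm x z := by
  simp only [herm, Pi.smul_apply, smul_eq_mul, mul_add, Finset.mul_sum]
  congr 1
  · ring
  · exact Finset.sum_congr rfl fun _ _ => by ring

theorem star_herm (x z : V n) : star (herm x z) = herm z x := by
  simp only [herm, star_add, star_neg, star_mul', star_star, star_sum]
  congr 1
  · ring
  · exact Finset.sum_congr rfl fun _ _ => by ring

theorem herm_add_right (x y z : V n) : herm z (x + y) = herm z x + herm z y := by
  rw [← star_herm, herm_add_left, star_add, star_herm, star_herm]

theorem herm_smul_right (c : ℂ) (x z : V n) : herm z (c • x) = star c * herm z x := by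
  rw [← star_herm, herm_smul_left, star_mul', star_herm]

theorem circle_mul_star (c : Circle) : (c : ℂ) * star (c : ℂ) = 1 := by
  have h := Complex.mul_conj (c : ℂ)
  rw [Circle.normSq_coe] at h
  simpa using h

theorem herm_circle_smul (c : Circle) (x z : V n) :
    herm ((c : ℂ) • x) ((c : ℂ) • z) = herm x z := by
  rw [herm_smul_left, herm_smul_right, ← mul_assoc, circle_mul_star, one_mul]

end hermLemmas

/-! ### Complex hyperbolic space

Smooth manifolds that are quotients `q : A → Q` of a submanifold `A` of a vector space `W` by a
free and proper group action are handled through lifts, `q` being a submersion: a map into `Q` is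
smooth if and only if it has smooth local lifts to `A`, and its differential is the class of the
derivative of a lift modulo the tangent space of the orbit. -/

/-- The anti-de Sitter space `H₁²ⁿ⁺¹ = {w : ((w, w)) = -1}`. -/
def AdS (n : ℕ) : Type := {w : V n // herm w w = -1}

instance (n : ℕ) : MulAction Circle (AdS n) where
  smul c w := ⟨(c : ℂ) • w.1, by rw [herm_circle_smul]; exact w.2⟩
  one_smul w := Subtype.ext (one_smul ℂ w.1)
  mul_smul c d w := Subtype.ext (mul_smul (c : ℂ) (d : ℂ) w.1)

/-- Complex hyperbolic space `ℂHⁿ`, the base of the Hopf fibration `H₁²ⁿ⁺¹ → ℂHⁿ`. -/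
def CH (n : ℕ) : Type := MulAction.orbitRel.Quotient Circle (AdS n)

/-- The Hopf fibration `π₋`. -/
def CH.mk {n : ℕ} (w : AdS n) : CH n := Quotient.mk (MulAction.orbitRel Circle (AdS n)) w

/-- Pairs `(w, v)` with `w ∈ H₁²ⁿ⁺¹` and `v` in the horizontal space `T'_w = {v : ((v, w)) = 0}`. -/
def HorPair (n : ℕ) : Type := {p : V n × V n // herm p.1 p.1 = -1 ∧ herm p.2 p.1 = 0}

instance (n : ℕ) : MulAction Circle (HorPair n) where
  smul c p := ⟨((c : ℂ) • p.1.1, (c : ℂ) • p.1.2), by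
    rw [herm_circle_smul, herm_circle_smul]; exact p.2⟩
  one_smul p := Subtype.ext (one_smul ℂ p.1)
  mul_smul c d p := Subtype.ext (mul_smul (c : ℂ) (d : ℂ) p.1)

/-- The tangent bundle of `ℂHⁿ`: the class of `(w, v)` is the tangent vector at `π₋ w` whose
horizontal lift at `w` is `v`. -/
def TCH (n : ℕ) : Type := MulAction.orbitRel.Quotient Circle (HorPair n)

/-- The tangent vector `dπ₋ v` at `π₋ w`, for `v ∈ T'_w`. -/
def TCH.mk {n : ℕ} (p : HorPair n) : TCH n :=
  Quotient.mk (MulAction.orbitRel Circle (HorPair n)) p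

/-- The base point of `(w, v)`. -/
def HorPair.base {n : ℕ} (p : HorPair n) : AdS n := ⟨p.1.1, p.2.1⟩

/-- The projection `TℂHⁿ → ℂHⁿ`. -/
def TCH.base {n : ℕ} : TCH n → CH n :=
  Quotient.lift (fun p => CH.mk p.base) (by
    rintro p q ⟨c, rfl⟩
    exact Quotient.sound ⟨c, rfl⟩)

/-- The projection `v ↦ v + ((v, w)) w` of `ℂⁿ⁺¹` onto the horizontal space `T'_w`, `w ∈ H₁²ⁿ⁺¹`.
On `T_w H₁²ⁿ⁺¹` it is the horizontal part `𝓗 v = v + Re ((v, iw)) iw`. -/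
def hor {n : ℕ} (w v : V n) : V n := v + herm v w • w

section Geometry

variable {n : ℕ} {E H M : Type*} [NormedAddCommGroup E] [NormedSpace ℝ E] [TopologicalSpace H]
  (I : ModelWithCorners ℝ E H) [TopologicalSpace M] [ChartedSpace H M]

/-- `w : M → H₁²ⁿ⁺¹` is a smooth lift of `f : M → ℂHⁿ` near `x`. -/
def IsLiftNear (f : M → CH n) (w : M → AdS n) (x : M) : Prop :=
  ∀ᶠ y in 𝓝 x, ContMDiffAt I 𝓘(ℝ, V n) ∞ (fun z => (w z).1) y ∧ CH.mk (w y) = f y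

/-- `p : M → HorPair n` is a smooth lift of `N : M → TℂHⁿ` near `x`. -/
def IsFieldLiftNear (N : M → TCH n) (p : M → HorPair n) (x : M) : Prop :=
  ∀ᶠ y in 𝓝 x, ContMDiffAt I 𝓘(ℝ, V n × V n) ∞ (fun z => (p z).1) y ∧ TCH.mk (p y) = N y

/-- The derivative of a `ℂⁿ⁺¹`-valued map at `x` in the direction `X`. -/
def D (g : M → V n) (x : M) (X : TangentSpace I x) : V n := mfderiv I 𝓘(ℝ, V n) g x X

/-- The horizontal lift, at `w x`, of `df X ∈ TℂHⁿ`, where `w` is a lift of `f : M → ℂHⁿ`. -/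
def diffLift (w : M → V n) (x : M) (X : TangentSpace I x) : V n := hor (w x) (D I w x X)

/-- The horizontal lift, at `w x`, of `∇̄_X N`, where `∇̄` is the Levi-Civita connection of `ℂHⁿ`,
`N` is a vector field along `f : M → ℂHⁿ`, `w` is a lift of `f` and `ν` is the horizontal lift of
`N` along `w`. It is the horizontal part of the flat derivative of the `S¹`-equivariant extension
of `ν` in the direction `𝓗 (dw X) = dw X + ⟨dw X, iw⟩ iw`; that extension has the derivative `iν`
in the direction `iw`. -/
def covLift (w ν : M → V n) (x : M) (X : TangentSpace I x) : V n :=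
  hor (w x) (D I ν x X + (sp (D I w x X) (Complex.I • w x) : ℂ) • Complex.I • ν x)

end Geometry

section LeviCivita

variable {n : ℕ} {E : Type*} [NormedAddCommGroup E] [NormedSpace ℝ E]

theorem isBilinearMap_herm : IsBilinearMap ℝ (fun z w : V n => herm z w) where
  add_left := herm_add_left
  smul_left c x y := by
    have h := herm_smul_left (c : ℂ) x y
    simpa [Complex.real_smul] using h
  add_right x y z := herm_add_right y z x
  smul_right c x y := by
    have h := herm_smul_right (c : ℂ) y x
    simpa [Complex.real_smul] using h

theorem hasFDerivAt_herm {f g : E → V n} {x : E} (hf : DifferentiableAt ℝ f x)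
    (hg : DifferentiableAt ℝ g x) :
    DifferentiableAt ℝ (fun y => herm (f y) (g y)) x ∧ ∀ X,
      fderiv ℝ (fun y => herm (f y) (g y)) x X =
      herm (fderiv ℝ f x X) (g x) + herm (f x) (fderiv ℝ g x X) := by
  have h := (isBilinearMap_herm (n := n)).toContinuousBilinearMap.hasFDerivAt_of_bilinear
    hf.hasFDerivAt hg.hasFDerivAt
  refine ⟨h.differentiableAt, fun X => ?_⟩
  have h2 := h.fderiv
  change fderiv ℝ (fun y => herm (f y) (g y)) x = _ at h2
  rw [h2]
  simp [add_comm]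

theorem D_eq_fderiv (g : E → V n) (x X : E) : D 𝓘(ℝ, E) g x X = fderiv ℝ g x X := by
  exact congrArg (fun L : E →L[ℝ] V n => L X) mfderiv_eq_fderiv

theorem diffLift_eq (w : E → V n) (x X : E) :
    diffLift 𝓘(ℝ, E) w x X = hor (w x) (fderiv ℝ w x X) :=
  congrArg (hor (w x)) (D_eq_fderiv w x X)

theorem covLift_eq (w ν : E → V n) (x X : E) :
    covLift 𝓘(ℝ, E) w ν x X = hor (w x) (fderiv ℝ ν x X +
      (sp (fderiv ℝ w x X) (Complex.I • w x) : ℂ) • Complex.I • ν x) := by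
  have h := D_eq_fderiv w x X
  have h' := D_eq_fderiv ν x X
  rw [← h, ← h']; rfl

theorem hor_add (w a b : V n) : hor w (a + b) = hor w a + hor w b := by
  simp only [hor, herm_add_left]; module

theorem hor_smul (w a : V n) (c : ℂ) : hor w (c • a) = c • hor w a := by
  simp only [hor, herm_smul_left]; module

theorem hor_self (w : V n) (hw : herm w w = -1) : hor w w = 0 := by
  simp [hor, hw]

theorem hor_hor (w a : V n) (hw : herm w w = -1) : hor w (hor w a) = hor w a := by
  conv_lhs => rw [show hor w a = a + herm a w • w from rfl]
  rw [hor_add, hor_smul, hor_self w hw, smul_zero, add_zero]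

/-- The connection is compatible with the metric of `ℂHⁿ`. -/
theorem covLift_metric (w ν η : E → V n) (x X : E)
    (hν : herm (ν x) (w x) = 0) (hη : herm (η x) (w x) = 0)
    (dν : DifferentiableAt ℝ ν x) (dη : DifferentiableAt ℝ η x) :
    fderiv ℝ (fun y => herm (ν y) (η y)) x X =
      herm (covLift 𝓘(ℝ, E) w ν x X) (η x) + herm (ν x) (covLift 𝓘(ℝ, E) w η x X) := by
  have hη' : herm (w x) (η x) = 0 := by rw [← star_herm, hη, star_zero]
  rw [(hasFDerivAt_herm dν dη).2, covLift_eq, covLift_eq]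
  simp only [hor, herm_add_left, herm_add_right, herm_smul_left, herm_smul_right, hν, hη',
    Complex.star_def, Complex.conj_ofReal, Complex.conj_I]
  ring

/-- The connection is torsion-free. -/
theorem covLift_torsion_free (w : E → V n) (x X Y : E) (dw : ContDiffAt ℝ 2 w x)
    (hw : ∀ᶠ y in 𝓝 x, herm (w y) (w y) = -1) :
    covLift 𝓘(ℝ, E) w (fun y => diffLift 𝓘(ℝ, E) w y Y) x X =
      covLift 𝓘(ℝ, E) w (fun y => diffLift 𝓘(ℝ, E) w y X) x Y := by
  have d0 : DifferentiableAt ℝ w x := dw.differentiableAt (by norm_num)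
  have d1 : DifferentiableAt ℝ (fderiv ℝ w) x :=
    (dw.fderiv_right (m := 1) (by norm_num)).differentiableAt (by norm_num)
  have hx : herm (w x) (w x) = -1 := hw.self_of_nhds
  have key : ∀ X Y : E, covLift 𝓘(ℝ, E) w (fun y => diffLift 𝓘(ℝ, E) w y Y) x X =
      hor (w x) (fderiv ℝ (fderiv ℝ w) x X Y) +
        herm (fderiv ℝ w x Y) (w x) • hor (w x) (fderiv ℝ w x X) +
        herm (fderiv ℝ w x X) (w x) • hor (w x) (fderiv ℝ w x Y) := by
    intro X Y
    have dY : DifferentiableAt ℝ (fun y => fderiv ℝ w y Y) x :=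
      d1.clm_apply (differentiableAt_const Y)
    have dY' : fderiv ℝ (fun y => fderiv ℝ w y Y) x X = fderiv ℝ (fderiv ℝ w) x X Y := by
      rw [fderiv_clm_apply d1 (differentiableAt_const Y)]; simp
    have dh := (hasFDerivAt_herm dY d0).1
    have e1 : (fun y => diffLift 𝓘(ℝ, E) w y Y) =
        fun y => fderiv ℝ w y Y + herm (fderiv ℝ w y Y) (w y) • w y := by
      funext y; rw [diffLift_eq, hor]
    have hre : (herm (fderiv ℝ w x X) (w x)).re = 0 := by
      have h := (hasFDerivAt_herm d0 d0).2 X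
      have hc : (fun y => herm (w y) (w y)) =ᶠ[𝓝 x] fun _ => (-1 : ℂ) := hw
      rw [hc.fderiv_eq, fderiv_const_apply, ← star_herm (fderiv ℝ w x X) (w x)] at h
      have h' := congrArg Complex.re h
      simp at h'
      linarith
    have hsp : (sp (fderiv ℝ w x X) (Complex.I • w x) : ℂ) * Complex.I =
        herm (fderiv ℝ w x X) (w x) := by
      rw [sp, herm_smul_right]
      apply Complex.ext <;> simp [hre]
    rw [covLift_eq, diffLift_eq, e1, fderiv_fun_add dY (dh.fun_smul d0),
      fderiv_fun_smul dh d0]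
    simp only [add_apply, smul_apply, dY',
      ContinuousLinearMap.smulRight_apply, smul_smul, hsp, hor_add, hor_smul, hor_self _ hx,
      hor_hor _ _ hx, smul_zero, add_zero]
  have hs := (dw.isSymmSndFDerivAt (by simp)).eq X Y
  rw [key, key, hs]
  abel

end LeviCivita

section Geometry

variable {n : ℕ} {E H M : Type*} [NormedAddCommGroup E] [NormedSpace ℝ E] [TopologicalSpace H]
  (I : ModelWithCorners ℝ E H) [TopologicalSpace M] [ChartedSpace H M]

/-- `f : M → ℂHⁿ` is smooth near `x` and its differential at `x` is injective. -/
def IsImmersionAtCH (f : M → CH n) (x : M) : Prop :=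
  ∃ w : M → AdS n, IsLiftNear I f w x ∧
    ∀ X : TangentSpace I x, diffLift I (fun y => (w y).1) x X = 0 → X = 0

/-- `N` is, near `x`, a smooth vector field along `f : M → ℂHⁿ`, and `N x` is a unit vector
orthogonal to the image of `df` at `x`. -/
def IsUnitNormalAt (f : M → CH n) (N : M → TCH n) (x : M) : Prop :=
  (∀ᶠ y in 𝓝 x, (N y).base = f y) ∧
    ∃ p : M → HorPair n, IsFieldLiftNear I N p x ∧ sp (p x).1.2 (p x).1.2 = 1 ∧
      ∀ X : TangentSpace I x, sp (diffLift I (fun y => (p y).1.1) x X) (p x).1.2 = 0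

/-- With respect to the unit normal `N`, the structure vector `ξ = -JN` at `x` satisfies
`A ξ = μ ξ`, where `A` is the shape operator, `df (A X) = -∇̄_X N`. -/
def IsPrincipalStructureAt (N : M → TCH n) (μ : ℝ) (x : M) : Prop :=
  ∃ p : M → HorPair n, IsFieldLiftNear I N p x ∧ ∃ ξ : TangentSpace I x,
    diffLift I (fun y => (p y).1.1) x ξ = -(Complex.I • (p x).1.2) ∧
    -(covLift I (fun y => (p y).1.1) (fun y => (p y).1.2) x ξ) =
      (μ : ℂ) • diffLift I (fun y => (p y).1.1) x ξ

end Geometry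

/-- `c` is a geodesic of `ℂHⁿ` with the velocity field `v`, that is `v = ċ` and `∇̄_ċ ċ = 0`. -/
def IsGeodesic {n : ℕ} (c : ℝ → CH n) (v : ℝ → TCH n) : Prop :=
  (∀ t, (v t).base = c t) ∧ ∀ t, ∃ p : ℝ → HorPair n, IsFieldLiftNear 𝓘(ℝ, ℝ) v p t ∧
    diffLift 𝓘(ℝ, ℝ) (fun y => (p y).1.1) t (1 : ℝ) = (p t).1.2 ∧
    covLift 𝓘(ℝ, ℝ) (fun y => (p y).1.1) (fun y => (p y).1.2) t (1 : ℝ) = 0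

/-! ### The Stiefel manifold and the twistor spaces -/

/-- The indefinite Stiefel manifold `M_V = V_{1,1}(ℂ₁ⁿ⁺¹)` of pairs `(u₋, u₊)`. -/
def Stiefel (n : ℕ) : Type :=
  {u : V n × V n // herm u.1 u.1 = -1 ∧ herm u.2 u.2 = 1 ∧ herm u.1 u.2 = 0}

instance (n : ℕ) : MulAction Circle (Stiefel n) where
  smul c u := ⟨((c : ℂ) • u.1.1, (c : ℂ) • u.1.2), by
    rw [herm_circle_smul, herm_circle_smul, herm_circle_smul]; exact u.2⟩
  one_smul u := Subtype.ext (one_smul ℂ u.1)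
  mul_smul c d u := Subtype.ext (mul_smul (c : ℂ) (d : ℂ) u.1)

/-- `M_S`, the quotient of `M_V` by the circle action `(u₋, u₊) ↦ (e^{iθ} u₋, e^{iθ} u₊)`. -/
def MS (n : ℕ) : Type := MulAction.orbitRel.Quotient Circle (Stiefel n)

/-- The projection `M_V → M_S`. -/
def MS.mk {n : ℕ} (u : Stiefel n) : MS n := Quotient.mk (MulAction.orbitRel Circle (Stiefel n)) u

/-- The three types `+`, `-`, `0`. -/
inductive Kind : Type
  | plus
  | minus
  | zero

/-- The one-parameter group in `U(1,1)` that defines the twistor space of a given type. -/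
def flowMat : Kind → ℝ → Matrix (Fin 2) (Fin 2) ℂ
  | .plus, t => !![Complex.exp (t * Complex.I), 0; 0, Complex.exp (-(t * Complex.I))]
  | .minus, t => !![Complex.cosh t, Complex.sinh t; Complex.sinh t, Complex.cosh t]
  | .zero, t => !![1 + t * Complex.I, t; t, 1 - t * Complex.I]

/-- The derivative of `flowMat` at `t = 0`. -/
def genMat : Kind → Matrix (Fin 2) (Fin 2) ℂ
  | .plus => !![Complex.I, 0; 0, -Complex.I]
  | .minus => !![0, 1; 1, 0]
  | .zero => !![Complex.I, 1; 1, -Complex.I]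

/-- The row `(u₋, u₊)` times a `2 × 2` matrix. -/
def rmul {n : ℕ} (u : V n × V n) (g : Matrix (Fin 2) (Fin 2) ℂ) : V n × V n :=
  (g 0 0 • u.1 + g 1 0 • u.2, g 0 1 • u.1 + g 1 1 • u.2)

theorem flowMat_zero (s : Kind) : flowMat s 0 = 1 := by
  cases s <;> ext i j <;> fin_cases i <;> fin_cases j <;> simp [flowMat]

theorem flowMat_add (s : Kind) (a b : ℝ) : flowMat s (a + b) = flowMat s a * flowMat s b := by
  cases s <;> ext i j <;> fin_cases i <;> fin_cases j <;>
    simp [flowMat, add_mul, Complex.exp_add, Complex.cosh_add, Complex.sinh_add] <;>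
    ring_nf <;> simp [Complex.I_sq]

theorem star_exp_mul_I (t : ℝ) :
    star (Complex.exp (t * Complex.I)) = Complex.exp (-(t * Complex.I)) := by
  rw [Complex.star_def, ← Complex.exp_conj]; simp

theorem star_exp_neg_mul_I (t : ℝ) :
    star (Complex.exp (-(t * Complex.I))) = Complex.exp (t * Complex.I) := by
  rw [← star_exp_mul_I, star_star]

theorem star_cosh (t : ℝ) : star (Complex.cosh t) = Complex.cosh t := by
  rw [Complex.star_def, ← Complex.cosh_conj]; simp

theorem star_sinh (t : ℝ) : star (Complex.sinh t) = Complex.sinh t := by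
  rw [Complex.star_def, ← Complex.sinh_conj]; simp

theorem herm_comb {n : ℕ} (u : Stiefel n) (a b c d : ℂ) :
    herm (a • u.1.1 + b • u.1.2) (c • u.1.1 + d • u.1.2) = -(a * star c) + b * star d := by
  obtain ⟨⟨x, y⟩, h1, h2, h3⟩ := u
  have h4 : herm y x = 0 := by rw [← star_herm, h3, star_zero]
  simp only [herm_add_left, herm_add_right, herm_smul_left, herm_smul_right] at *
  rw [h1, h2, h3, h4]; ring

/-- The right action of the one-parameter group of type `s` on `M_V`. -/
def Stiefel.flow {n : ℕ} (s : Kind) (t : ℝ) (u : Stiefel n) : Stiefel n :=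
  ⟨rmul u.1 (flowMat s t), by
    have he : Complex.exp (t * Complex.I) * Complex.exp (-(t * Complex.I)) = 1 := by
      rw [← Complex.exp_add]; simp
    have hc := Complex.cosh_sq_sub_sinh_sq (t : ℂ)
    have hI := Complex.I_sq
    simp only [rmul, herm_comb]
    cases s
    · simp only [flowMat, Matrix.of_apply, Matrix.cons_val', Matrix.cons_val_zero,
        Matrix.cons_val_one, Matrix.cons_val_fin_one, star_exp_mul_I, star_exp_neg_mul_I, star_zero]
      refine ⟨?_, ?_, ?_⟩
      · linear_combination -he
      · linear_combination he
      · ring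
    · simp [flowMat, star_cosh, star_sinh, -Complex.star_def]
      refine ⟨?_, ?_, ?_⟩
      · linear_combination -hc
      · linear_combination hc
      · ring
    · simp [flowMat]
      refine ⟨?_, ?_, ?_⟩
      · linear_combination (t : ℂ) ^ 2 * hI
      · linear_combination -(t : ℂ) ^ 2 * hI
      · ring⟩

theorem Stiefel.flow_smul {n : ℕ} (s : Kind) (t : ℝ) (c : Circle) (u : Stiefel n) :
    Stiefel.flow s t (c • u) = c • Stiefel.flow s t u := by
  apply Subtype.ext
  change rmul ((c : ℂ) • u.1.1, (c : ℂ) • u.1.2) (flowMat s t) =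
    ((c : ℂ) • (rmul u.1 (flowMat s t)).1, (c : ℂ) • (rmul u.1 (flowMat s t)).2)
  simp only [rmul, smul_add, smul_smul, mul_comm]

theorem Stiefel.flow_zero {n : ℕ} (s : Kind) (u : Stiefel n) : Stiefel.flow s 0 u = u := by
  apply Subtype.ext
  change rmul u.1 (flowMat s 0) = u.1
  rw [flowMat_zero]
  simp [rmul]

theorem Stiefel.flow_flow {n : ℕ} (s : Kind) (a b : ℝ) (u : Stiefel n) :
    Stiefel.flow s b (Stiefel.flow s a u) = Stiefel.flow s (a + b) u := by
  apply Subtype.ext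
  change rmul (rmul u.1 (flowMat s a)) (flowMat s b) = rmul u.1 (flowMat s (a + b))
  rw [flowMat_add]
  simp only [rmul, Matrix.mul_apply, Fin.sum_univ_two]
  ext1 <;> simp only <;> module

/-- The action of the one-parameter group of type `s` on `M_S`. -/
def MS.flow {n : ℕ} (s : Kind) (t : ℝ) : MS n → MS n :=
  Quotient.map (Stiefel.flow s t) (by
    rintro u v ⟨c, rfl⟩
    exact ⟨c, (Stiefel.flow_smul s t c v).symm⟩)

theorem MS.flow_mk {n : ℕ} (s : Kind) (t : ℝ) (u : Stiefel n) :
    MS.flow s t (MS.mk u) = MS.mk (Stiefel.flow s t u) := rfl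

/-- The orbit relation of the one-parameter group of type `s` on `M_S`. -/
def twistorSetoid (s : Kind) (n : ℕ) : Setoid (MS n) where
  r x y := ∃ t : ℝ, MS.flow s t x = y
  iseqv := by
    have h0 : ∀ x : MS n, MS.flow s 0 x = x := by
      rintro ⟨u⟩; exact congrArg MS.mk (Stiefel.flow_zero s u)
    have h1 : ∀ (a b : ℝ) (x : MS n), MS.flow s b (MS.flow s a x) = MS.flow s (a + b) x := by
      rintro a b ⟨u⟩; exact congrArg MS.mk (Stiefel.flow_flow s a b u)
    refine ⟨fun x => ⟨0, h0 x⟩, ?_, ?_⟩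
    · rintro x y ⟨t, rfl⟩
      exact ⟨-t, by rw [h1, add_neg_cancel, h0]⟩
    · rintro x y z ⟨t, rfl⟩ ⟨t', rfl⟩
      exact ⟨t + t', by rw [h1]⟩

/-- The twistor space `M_Z^s` of the Grassmannian `𝔾_{1,1}(ℂ₁ⁿ⁺¹)`. -/
def MZ (s : Kind) (n : ℕ) : Type := Quotient (twistorSetoid s n)

/-- The projection `M_S → M_Z^s`. -/
def MZ.mk {n : ℕ} (s : Kind) (x : MS n) : MZ s n := Quotient.mk (twistorSetoid s n) x

theorem MZ.mk_flow {n : ℕ} (s : Kind) (t : ℝ) (x : MS n) : MZ.mk s (MS.flow s t x) = MZ.mk s x :=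
  Quotient.sound ((twistorSetoid s n).symm ⟨t, rfl⟩)

/-- The kernel of the differential of `M_V → M_Z^s` at `u`, that is, the tangent space of the orbit
of `u` under the circle and the one-parameter group of type `s`. -/
def orbitTangent {n : ℕ} (s : Kind) (u : Stiefel n) : Submodule ℝ (V n × V n) :=
  Submodule.span ℝ {(Complex.I • u.1.1, Complex.I • u.1.2), rmul u.1 (genMat s)}

/-- The horizontal space `T'_u = {u₋, u₊}^⊥ × {u₋, u₊}^⊥` of the fibration of `M_V` over
`𝔾_{1,1}(ℂ₁ⁿ⁺¹)`, whose fibres are the orbits of the right action of `U(1,1)`. -/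
def horSpace {n : ℕ} (u : Stiefel n) : Set (V n × V n) :=
  {X | herm X.1 u.1.1 = 0 ∧ herm X.1 u.1.2 = 0 ∧ herm X.2 u.1.1 = 0 ∧ herm X.2 u.1.2 = 0}

section Construction

variable {n : ℕ} {E H S : Type*} [NormedAddCommGroup E] [NormedSpace ℝ E] [TopologicalSpace H]
  (I : ModelWithCorners ℝ E H) [TopologicalSpace S] [ChartedSpace H S]

/-- `u : U → M_V` is a smooth lift of `φ : S → M_Z^s` over the open set `U`. -/
structure IsLocalLift {s : Kind} (φ : S → MZ s n) (U : TopologicalSpace.Opens S)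
    (u : U → Stiefel n) : Prop where
  smooth : ContMDiff I 𝓘(ℝ, V n × V n) ∞ (fun p => (u p).1)
  lift : ∀ p : U, MZ.mk s (MS.mk (u p)) = φ p

/-- `φ : S → M_Z^s` is smooth with injective differential. -/
structure IsTwistorImmersion {s : Kind} (φ : S → MZ s n) : Prop where
  smooth : ∀ p : S, ∃ (U : TopologicalSpace.Opens S) (u : U → Stiefel n),
    p ∈ U ∧ IsLocalLift I φ U u
  injective : ∀ (U : TopologicalSpace.Opens S) (u : U → Stiefel n), IsLocalLift I φ U u →
    ∀ (p : U) (X : TangentSpace I p),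
      mfderiv I 𝓘(ℝ, V n × V n) (fun q => (u q).1) p X ∈ orbitTangent s (u p) → X = 0

/-- `φ : S → M_Z^s` is horizontal for the twistor fibration `M_Z^s → 𝔾_{1,1}(ℂ₁ⁿ⁺¹)`: its
differential takes values in the image of `T'_u` in the tangent space of `M_Z^s`, that is, the
derivative of a lift to `M_V` takes values in the sum of `T'_u` and `orbitTangent s u`. -/
def IsHorizontal {s : Kind} (φ : S → MZ s n) : Prop :=
  ∀ (U : TopologicalSpace.Opens S) (u : U → Stiefel n), IsLocalLift I φ U u →
    ∀ (p : U) (X : TangentSpace I p), ∃ h ∈ horSpace (u p),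
      ∃ k ∈ orbitTangent s (u p), mfderiv I 𝓘(ℝ, V n × V n) (fun q => (u q).1) p X = h + k

/-- The pull-back bundle `Σ_S = φ^* M_S` over `S`. -/
def PullS {s : Kind} (φ : S → MZ s n) : Type _ := {y : S × MS n // φ y.1 = MZ.mk s y.2}

variable {I} in
/-- The local trivialization `(t, p) ↦ (p, [u(p) g_t])`, `ℝ × U → Σ_S`, given by a local lift `u`
of `φ`, where `g_t` is the one-parameter group of type `s`. These surjections onto the parts of
`Σ_S` over the sets `U` are local diffeomorphisms; they define the smooth structure of `Σ_S`. -/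
def triv {s : Kind} {φ : S → MZ s n} {U : TopologicalSpace.Opens S} {u : U → Stiefel n}
    (hu : IsLocalLift I φ U u) (m : ℝ × U) : PullS φ :=
  ⟨(m.2, MS.mk (Stiefel.flow s m.1 (u m.2))), by
    rw [← MS.flow_mk, MZ.mk_flow, hu.lift]⟩

/-- `F : Σ_S → ℂHⁿ` is an immersion at `y`. -/
def PullS.IsImmersionAt {s : Kind} {φ : S → MZ s n} (F : PullS φ → CH n) (y : PullS φ) : Prop :=
  ∀ (U : TopologicalSpace.Opens S) (u : U → Stiefel n) (hu : IsLocalLift I φ U u) (m : ℝ × U),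
    triv hu m = y → IsImmersionAtCH (𝓘(ℝ, ℝ).prod I) (fun m' => F (triv hu m')) m

/-- Near `y`, `N` is a smooth vector field along `F : Σ_S → ℂHⁿ`, and `N y` is a unit vector
orthogonal to the image of `dF` at `y`. -/
def PullS.IsUnitNormalAt {s : Kind} {φ : S → MZ s n} (F : PullS φ → CH n) (N : PullS φ → TCH n)
    (y : PullS φ) : Prop :=
  ∀ (U : TopologicalSpace.Opens S) (u : U → Stiefel n) (hu : IsLocalLift I φ U u) (m : ℝ × U),
    triv hu m = y → HopfTwistor.IsUnitNormalAt (𝓘(ℝ, ℝ).prod I) (fun m' => F (triv hu m'))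
      (fun m' => N (triv hu m')) m

/-- At `y`, the map `F : Σ_S → ℂHⁿ` is an immersion with the unit normal `N`, and the structure
vector `ξ = -JN` satisfies `A ξ = μ ξ`. -/
structure PullS.IsHopfAt {s : Kind} {φ : S → MZ s n} (F : PullS φ → CH n) (N : PullS φ → TCH n)
    (μ : ℝ) (y : PullS φ) : Prop where
  immersion : PullS.IsImmersionAt I F y
  normal : PullS.IsUnitNormalAt I F N y
  principal : ∀ (U : TopologicalSpace.Opens S) (u : U → Stiefel n) (hu : IsLocalLift I φ U u)
    (m : ℝ × U), triv hu m = y →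
      IsPrincipalStructureAt (𝓘(ℝ, ℝ).prod I) (fun m' => N (triv hu m')) μ m

/-- `(τ, y)` is a critical point of the smooth map `(τ, y) ↦ G τ y`, `ℝ × Σ_S → ℂHⁿ`, of manifolds
of the same dimension. For a hypersurface `F` with unit normal field `N` and
`G τ y = exp (τ N y)`, such a pair is a focal point of `F`. -/
def PullS.IsCriticalAt {s : Kind} {φ : S → MZ s n} (G : ℝ → PullS φ → CH n) (τ : ℝ)
    (y : PullS φ) : Prop :=
  ¬ ∀ (U : TopologicalSpace.Opens S) (u : U → Stiefel n) (hu : IsLocalLift I φ U u) (m : ℝ × U),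
    triv hu m = y → IsImmersionAtCH (𝓘(ℝ, ℝ).prod (𝓘(ℝ, ℝ).prod I))
      (fun a : ℝ × (ℝ × U) => G a.1 (triv hu a.2)) (τ, m)

end Construction

/-- The factor `1` or `i` in the definition of `p̃_r^s`. -/
def Kind.factor : Kind → ℂ
  | .plus => 1
  | .minus => Complex.I
  | .zero => Complex.I

/-- The map `p̃_r^s : M_V → H₁²ⁿ⁺¹`, equal to `cosh r u₋ + sinh r u₊` for `s = +` and to
`cosh r u₋ + i sinh r u₊` for `s = -, 0`. -/
def ptilde {n : ℕ} (s : Kind) (r : ℝ) (u : Stiefel n) : AdS n :=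
  ⟨Complex.cosh r • u.1.1 + (s.factor * Complex.sinh r) • u.1.2, by
    have hc := Complex.cosh_sq_sub_sinh_sq (r : ℂ)
    have hs : s.factor * star s.factor = 1 := by cases s <;> simp [Kind.factor]
    rw [herm_comb, star_mul', star_cosh, star_sinh]
    linear_combination Complex.sinh r ^ 2 * hs - hc⟩

/-- The map `p_r^s : M_S → ℂHⁿ` induced by `p̃_r^s`. -/
def pmap {n : ℕ} (s : Kind) (r : ℝ) : MS n → CH n :=
  Quotient.lift (fun u => CH.mk (ptilde s r u)) (by
    rintro u v ⟨c, rfl⟩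
    refine Quotient.sound ⟨c, Subtype.ext ?_⟩
    change (c : ℂ) • (Complex.cosh r • v.1.1 + (s.factor * Complex.sinh r) • v.1.2) =
      Complex.cosh r • ((c : ℂ) • v.1.1) + (s.factor * Complex.sinh r) • ((c : ℂ) • v.1.2)
    module)

/-- The map `Φ_r^s = p_r^s ∘ ψ_s : Σ_S → ℂHⁿ`, where `ψ_s : Σ_S → M_S` is the bundle map. -/
def Phi {n : ℕ} {S : Type*} {s : Kind} (φ : S → MZ s n) (r : ℝ) (y : PullS φ) : CH n :=
  pmap s r y.1.2

/-- The range of the Hopf curvature for each type. -/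
def Kind.HopfBound : Kind → ℝ → Prop
  | .plus, μ => 2 < |μ|
  | .minus, μ => |μ| < 2
  | .zero, μ => |μ| = 2

end HopfTwistor

end

open HopfTwistor

/-! Everything is computed upstairs, on lifts. With f the factor 1 or i, put w_r = cosh r u₋ + f
sinh r u₊ and ν_r = dw_r/dr. The vector ν_r is a horizontal unit vector at w_r, and dν_r/dr = w_r
has no horizontal part, so the curves in r are geodesics and ν_r descends to the field N_r. The
tangent space of Σ_S is spanned by the flow direction ∂_t and lifts of directions in Σ. By
horizontality of φ, the latter contribute vectors orthogonal to u₋, u₊, hence to ν_r, up to orbit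
directions. The circle direction maps to i w_r and vanishes in ℂHⁿ; the generator maps to -λ(r) iν_r
(`hor_gen`), which is real-orthogonal to ν_r. Thus N_r is normal to the image for every r
(`sp_diffLift_flowPair`). The functions λ = `Kind.speed` are sinh 2r, cosh 2r, e^{2r} for s = +, -,
0. Since iν_r is parallel along the geodesics, ∇̄ of N_r along ∂_t is -λ' iν_r (`hor_gen_normal`).
Where λ ≠ 0, ξ = -iν_r is the image of ∂_t/λ and is principal with μ = -λ'/λ, that is -2 coth 2r, -2
tanh 2r or -2. For focal points, the normal exponential map has differential (a, X) ↦ aν + dΦ(X)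
with dΦ(X) orthogonal to the unit vector ν, so it is injective exactly when dΦ is
(`isImmersionAtCH_param_iff`). -/

noncomputable section

namespace HopfTwistor

/-! ### Independence of the differential from the choice of lift. -/

section Lifts

variable {n : ℕ} {E H M : Type*} [NormedAddCommGroup E] [NormedSpace ℝ E] [TopologicalSpace H]
  {I : ModelWithCorners ℝ E H} [TopologicalSpace M] [ChartedSpace H M]

/-- The chain rule for a map of normed spaces after a map defined on a manifold. -/
theorem mfderiv_normedSpace_comp_apply {F F' : Type*} [NormedAddCommGroup F] [NormedSpace ℝ F]
    [NormedAddCommGroup F'] [NormedSpace ℝ F'] {G : F → F'} {g : M → F} {x : M}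
    (hG : DifferentiableAt ℝ G (g x)) (hg : MDifferentiableAt I 𝓘(ℝ, F) g x)
    (X : TangentSpace I x) :
    mfderiv I 𝓘(ℝ, F') (fun y => G (g y)) x X =
      fderiv ℝ G (g x) (mfderiv I 𝓘(ℝ, F) g x X) := by
  have h := mfderiv_comp x hG.mdifferentiableAt hg
  have h' := congrArg (fun L : TangentSpace I x →L[ℝ] F' => L X) h
  rw [mfderiv_eq_fderiv] at h'
  exact h'

theorem contDiff_herm : ContDiff ℝ ∞ (fun a : V n × V n => herm a.1 a.2) :=
  (isBilinearMap_herm (n := n)).toContinuousBilinearMap.isBoundedBilinearMap.contDiff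

theorem hor_smul_base (c : Circle) (w a : V n) :
    hor ((c : ℂ) • w) ((c : ℂ) • a) = (c : ℂ) • hor w a := by
  simp only [hor, herm_circle_smul]; module

/-- The differentials computed from two lifts of the same map differ by a phase. -/
theorem exists_diffLift_eq_smul {f : M → CH n} {w w' : M → AdS n} {x : M}
    (hw : IsLiftNear I f w x) (hw' : IsLiftNear I f w' x) :
    ∃ c : Circle, ∀ X : TangentSpace I x,
      diffLift I (fun y => (w y).1) x X = (c : ℂ) • diffLift I (fun y => (w' y).1) x X := by
  -- The form recovers the phase: w = c w' and ((w', w')) = -1 give c = -((w, w')), an expression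
  -- smooth in y although c itself comes from a pointwise choice.
  have key : ∀ y, CH.mk (w y) = f y → CH.mk (w' y) = f y →
      ∃ c : Circle, (w y).1 = (c : ℂ) • (w' y).1 ∧ -herm (w y).1 (w' y).1 = c := by
    intro y h h'
    obtain ⟨c, hc⟩ := Quotient.exact (h.trans h'.symm)
    have hc' : (c : ℂ) • (w' y).1 = (w y).1 := congrArg Subtype.val hc
    refine ⟨c, hc'.symm, ?_⟩
    rw [← hc', herm_smul_left, (w' y).2]; ring
  obtain ⟨c, hc, hc'⟩ := key x hw.self_of_nhds.2 hw'.self_of_nhds.2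
  refine ⟨c, fun X => ?_⟩
  have dw := hw.self_of_nhds.1.mdifferentiableAt (by simp)
  have dw' := hw'.self_of_nhds.1.mdifferentiableAt (by simp)
  have dpair := dw.prodMk_space dw'
  have dk : MDifferentiableAt I 𝓘(ℝ, ℂ) (fun y => -herm (w y).1 (w' y).1) x :=
    (contDiff_herm.neg.differentiable (by simp)).differentiableAt.mdifferentiableAt.comp
      (g := fun a : V n × V n => -herm a.1 a.2) x dpair
  have dkw := dk.prodMk_space dw'
  have dG : DifferentiableAt ℝ (fun a : ℂ × V n => a.1 • a.2)
    (-herm (w x).1 (w' x).1, (w' x).1) := by fun_prop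
  have hev : (fun y => (w y).1) =ᶠ[𝓝 x]
      fun y => (fun a : ℂ × V n => a.1 • a.2) (-herm (w y).1 (w' y).1, (w' y).1) := by
    filter_upwards [hw, hw'] with y h h'
    obtain ⟨d, hd, hd'⟩ := key y h.2 h'.2
    exact hd.trans (congrArg (· • (w' y).1) hd'.symm)
  have h1 := congrArg (fun L : TangentSpace I x →L[ℝ] V n => L X)
    (hev.mfderiv_eq (I := I) (I' := 𝓘(ℝ, V n)))
  have h2 := mfderiv_normedSpace_comp_apply
    (g := fun y => (-herm (w y).1 (w' y).1, (w' y).1)) dG dkw X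
  have h3 : mfderiv I 𝓘(ℝ, V n) (fun y => (w' y).1) x X =
      (mfderiv I 𝓘(ℝ, ℂ × V n) (fun y => (-herm (w y).1 (w' y).1, (w' y).1)) x X).2 := by
    have h := mfderiv_normedSpace_comp_apply (G := Prod.snd)
      (g := fun y => (-herm (w y).1 (w' y).1, (w' y).1)) differentiableAt_snd dkw X
    rw [fderiv_snd] at h
    exact h
  have h4 : ∀ Y : ℂ × V n, fderiv ℝ (fun a : ℂ × V n => a.1 • a.2)
      (-herm (w x).1 (w' x).1, (w' x).1) Y = (c : ℂ) • Y.2 + Y.1 • (w' x).1 := by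
    intro Y
    rw [fderiv_fun_smul differentiableAt_fst differentiableAt_snd]
    simp [fderiv_fst, fderiv_snd, ← hc']
  have h5 : D I (fun y => (w y).1) x X = (c : ℂ) • D I (fun y => (w' y).1) x X +
      (mfderiv I 𝓘(ℝ, ℂ × V n) (fun y => (-herm (w y).1 (w' y).1, (w' y).1)) x X).1 •
        (w' x).1 := by
    refine (h1.trans (h2.trans (h4 _))).trans ?_
    rw [D, h3]
  -- The derivative of the phase contributes only a multiple of w', which is vertical and disappears
  -- under `hor`.
  have h0 : hor ((c : ℂ) • (w' x).1) ((w' x).1) = 0 := by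
    simp only [hor, herm_smul_right, (w' x).2, smul_smul]
    rw [mul_neg_one, neg_mul, mul_comm, circle_mul_star]; simp
  rw [diffLift, diffLift, h5, hc, hor_add, hor_smul_base, hor_smul, h0, smul_zero, add_zero]

/-- Injectivity of the differential may be tested on any lift. -/
theorem isImmersionAtCH_iff {f : M → CH n} {w : M → AdS n} {x : M} (hw : IsLiftNear I f w x) :
    IsImmersionAtCH I f x ↔
      ∀ X : TangentSpace I x, diffLift I (fun y => (w y).1) x X = 0 → X = 0 := by
  refine ⟨?_, fun h => ⟨w, hw, h⟩⟩
  rintro ⟨w', hw', h⟩ X hX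
  obtain ⟨c, hc⟩ := exists_diffLift_eq_smul hw' hw
  exact h X (by rw [hc, hX, smul_zero])

end Lifts

/-! ### Algebra in the plane spanned by u₋ and u₊. -/

section Frames

variable {n : ℕ}

/-- The linear map `(x, y) ↦ a x + b y`. -/
def comb (a b : ℂ) : V n × V n →L[ℝ] V n :=
  a • ContinuousLinearMap.fst ℝ (V n) (V n) + b • ContinuousLinearMap.snd ℝ (V n) (V n)

theorem comb_apply (a b : ℂ) (v : V n × V n) : comb a b v = a • v.1 + b • v.2 := rfl

/-- The vector `dp̃_r^s / dr`, the horizontal lift of the unit normal. -/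
def normalPair (s : Kind) (r : ℝ) (u : Stiefel n) : HorPair n :=
  ⟨((ptilde s r u).1, comb (Complex.sinh r) (s.factor * Complex.cosh r) u.1),
    (ptilde s r u).2, by
      have hs : s.factor * star s.factor = 1 := by cases s <;> simp [Kind.factor]
      simp only [ptilde, comb_apply]
      rw [herm_comb, star_mul', star_cosh, star_sinh]
      linear_combination Complex.sinh r * Complex.cosh r * hs⟩

theorem normalPair_snd (s : Kind) (r : ℝ) (u : Stiefel n) :
    (normalPair s r u).1.2 = comb (Complex.sinh r) (s.factor * Complex.cosh r) u.1 := rfl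

theorem normalPair_fst (s : Kind) (r : ℝ) (u : Stiefel n) :
    (normalPair s r u).1.1 = comb (Complex.cosh r) (s.factor * Complex.sinh r) u.1 := rfl

/-- The unit normal as a map `M_S → TℂHⁿ`. -/
def normalMap (s : Kind) (r : ℝ) : MS n → TCH n :=
  Quotient.lift (fun u => TCH.mk (normalPair s r u)) (by
    rintro u v ⟨c, rfl⟩
    refine Quotient.sound ⟨c, Subtype.ext (Prod.ext ?_ ?_)⟩
    · change (c : ℂ) • comb _ _ v.1 = comb _ _ ((c : ℂ) • v.1.1, (c : ℂ) • v.1.2)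
      simp only [comb_apply]; module
    · change (c : ℂ) • comb _ _ v.1 = comb _ _ ((c : ℂ) • v.1.1, (c : ℂ) • v.1.2)
      simp only [comb_apply]; module)

theorem normalMap_base (s : Kind) (r : ℝ) (x : MS n) : (normalMap s r x).base = pmap s r x := by
  obtain ⟨u⟩ := x; rfl

/-- The factor `λ` such that the generator of the flow of type `s` is mapped to `-λ i ν`, with `ν`
the unit normal. -/
def Kind.speed : Kind → ℝ → ℝ
  | .plus, r => 2 * Real.sinh r * Real.cosh r
  | .minus, r => Real.cosh r ^ 2 + Real.sinh r ^ 2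
  | .zero, r => (Real.cosh r + Real.sinh r) ^ 2

/-- The derivative of `Kind.speed`. -/
def Kind.speedDeriv : Kind → ℝ → ℝ
  | .plus, r => 2 * (Real.cosh r ^ 2 + Real.sinh r ^ 2)
  | .minus, r => 4 * Real.sinh r * Real.cosh r
  | .zero, r => 2 * (Real.cosh r + Real.sinh r) ^ 2

theorem herm_normal (s : Kind) (r : ℝ) (u : Stiefel n) :
    herm (normalPair s r u).1.2 (normalPair s r u).1.2 = 1 := by
  have hs : s.factor * star s.factor = 1 := by cases s <;> simp [Kind.factor]
  have hc := Complex.cosh_sq_sub_sinh_sq (r : ℂ)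
  rw [normalPair_snd, comb_apply, herm_comb, star_mul', star_cosh, star_sinh]
  linear_combination Complex.cosh r ^ 2 * hs + hc

/-- The horizontal projection at a point of the plane span{u₋, u₊} preserves that plane, so
identities about the generator reduce to identities between two scalar coefficients. -/
theorem hor_comb_comb (u : Stiefel n) (a b c d : ℂ) :
    hor (comb c d u.1) (comb a b u.1) =
      comb (a + (-(a * star c) + b * star d) * c) (b + (-(a * star c) + b * star d) * d) u.1 := by
  simp only [hor, comb_apply, herm_comb]; module

theorem comb_rmul (a b : ℂ) (v : V n × V n) (g : Matrix (Fin 2) (Fin 2) ℂ) :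
    comb a b (rmul v g) = comb (g 0 0 * a + g 0 1 * b) (g 1 0 * a + g 1 1 * b) v := by
  simp only [comb_apply, rmul]; module

theorem smul_comb (k a b : ℂ) (v : V n × V n) : k • comb a b v = comb (k * a) (k * b) v := by
  simp only [comb_apply]; module

/-- The horizontal part of the image of the generator. -/
theorem hor_gen (s : Kind) (r : ℝ) (u : Stiefel n) :
    hor (normalPair s r u).1.1
      (comb (Complex.cosh r) (s.factor * Complex.sinh r) (rmul u.1 (genMat s))) =
      (-(s.speed r : ℂ)) • Complex.I • (normalPair s r u).1.2 := by
  have hc := Complex.cosh_sq_sub_sinh_sq (r : ℂ)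
  have hI := Complex.I_sq
  rw [normalPair_fst, normalPair_snd, comb_rmul, hor_comb_comb, smul_comb, smul_comb,
    star_mul', star_cosh, star_sinh]
  -- The two coefficients become polynomials in c, d, j subject only to c² - d² = 1 and j² = -1.
  cases s <;> simp only [genMat, Kind.factor, Kind.speed, Matrix.of_apply, Matrix.cons_val',
    Matrix.cons_val_zero, Matrix.cons_val_one, Matrix.cons_val_fin_one, Complex.star_def, map_one,
    Complex.conj_I, Complex.ofReal_mul, Complex.ofReal_add, Complex.ofReal_pow,
    Complex.ofReal_cosh, Complex.ofReal_sinh, Complex.ofReal_ofNat] <;>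
    generalize Complex.cosh r = c at * <;> generalize Complex.sinh r = d at * <;>
    generalize Complex.I = j at * <;> congr 2 <;> grind

/-- This is the vertical component of the generator, needed for the correction term in `covLift`. It
is real because w stays in {((w, w)) = -1}, which makes ((dw, w)) imaginary. -/
theorem herm_gen (s : Kind) (r : ℝ) (u : Stiefel n) :
    herm (comb (Complex.cosh r) (s.factor * Complex.sinh r) (rmul u.1 (genMat s)))
      (Complex.I • (normalPair s r u).1.1) = ((-(s.speedDeriv r / 2) : ℝ) : ℂ) := by
  have hc := Complex.cosh_sq_sub_sinh_sq (r : ℂ)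
  have hI := Complex.I_sq
  rw [normalPair_fst, comb_rmul, herm_smul_right, comb_apply, comb_apply, herm_comb,
    star_mul', star_cosh, star_sinh]
  cases s <;> simp only [genMat, Kind.factor, Kind.speedDeriv, Matrix.of_apply, Matrix.cons_val',
    Matrix.cons_val_zero, Matrix.cons_val_one, Matrix.cons_val_fin_one, Complex.star_def, map_one,
    Complex.conj_I, Complex.ofReal_mul, Complex.ofReal_add, Complex.ofReal_pow, Complex.ofReal_neg,
    Complex.ofReal_div, Complex.ofReal_cosh, Complex.ofReal_sinh, Complex.ofReal_ofNat] <;>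
    generalize Complex.cosh r = c at * <;> generalize Complex.sinh r = d at * <;>
    generalize Complex.I = j at * <;> grind

/-- The horizontal part of the covariant derivative of the normal along the generator. -/
theorem hor_gen_normal (s : Kind) (r : ℝ) (u : Stiefel n) :
    hor (normalPair s r u).1.1
      (comb (Complex.sinh r) (s.factor * Complex.cosh r) (rmul u.1 (genMat s)) +
        (sp (comb (Complex.cosh r) (s.factor * Complex.sinh r) (rmul u.1 (genMat s)))
          (Complex.I • (normalPair s r u).1.1) : ℂ) • Complex.I • (normalPair s r u).1.2) =
      (-(s.speedDeriv r : ℂ)) • Complex.I • (normalPair s r u).1.2 := by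
  have hc := Complex.cosh_sq_sub_sinh_sq (r : ℂ)
  have hI := Complex.I_sq
  have hν : hor (normalPair s r u).1.1 (normalPair s r u).1.2 = (normalPair s r u).1.2 := by
    simp [hor, (normalPair s r u).2.2]
  -- The correction term supplies one half of -λ' iν; the horizontal part of the flat derivative
  -- supplies the other half.
  rw [sp, herm_gen, Complex.ofReal_re, hor_add, hor_smul, hor_smul, hν, normalPair_fst,
    normalPair_snd, comb_rmul, hor_comb_comb, smul_comb, smul_comb, smul_comb,
    star_mul', star_cosh, star_sinh, comb_apply, comb_apply, comb_apply,
    add_add_add_comm, ← add_smul, ← add_smul]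
  cases s <;> simp only [genMat, Kind.factor, Kind.speedDeriv, Matrix.of_apply, Matrix.cons_val',
    Matrix.cons_val_zero, Matrix.cons_val_one, Matrix.cons_val_fin_one, Complex.star_def, map_one,
    Complex.conj_I, Complex.ofReal_mul, Complex.ofReal_add, Complex.ofReal_pow, Complex.ofReal_neg,
    Complex.ofReal_div, Complex.ofReal_cosh, Complex.ofReal_sinh, Complex.ofReal_ofNat] <;>
    generalize Complex.cosh r = c at * <;> generalize Complex.sinh r = d at * <;>
    generalize Complex.I = j at * <;> congr 2 <;> grind

/-- A value of the Hopf curvature, which is determined if `s.speed r ≠ 0`. -/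
theorem Kind.exists_hopfCurvature (s : Kind) (r : ℝ) :
    ∃ μ : ℝ, s.HopfBound μ ∧ (s.speed r ≠ 0 → s.speedDeriv r = -μ * s.speed r) := by
  have hc := Real.cosh_sq_sub_sinh_sq r
  -- This quantity and the next are e^{2r} and e^{-2r}; their positivity gives |2 sinh r cosh r| <
  -- cosh² r + sinh² r, which separates the types + and -.
  have hadd : 0 < Real.cosh r ^ 2 + Real.sinh r ^ 2 + 2 * (Real.sinh r * Real.cosh r) := by
    nlinarith [Real.cosh_add_sinh r, pow_pos (Real.exp_pos r) 2]
  have hsub : 0 < Real.cosh r ^ 2 + Real.sinh r ^ 2 - 2 * (Real.sinh r * Real.cosh r) := by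
    nlinarith [Real.cosh_sub_sinh r, pow_pos (Real.exp_pos (-r)) 2]
  by_cases h0 : s.speed r = 0
  · cases s
    -- Only type + at r = 0 reaches this case; the equation for μ is then vacuous and any number
    -- above 2 serves.
    · exact ⟨3, by norm_num [Kind.HopfBound], fun h => absurd h0 h⟩
    · simp only [Kind.speed] at h0; nlinarith [sq_nonneg (Real.sinh r)]
    · simp only [Kind.speed] at h0; nlinarith [pow_eq_zero_iff (two_ne_zero) |>.1 h0]
  · refine ⟨-(s.speedDeriv r / s.speed r), ?_, fun _ => by field_simp⟩
    have hpos : 0 < |s.speed r| := abs_pos.2 h0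
    cases s <;> simp only [Kind.HopfBound, abs_neg, abs_div]
    · rw [lt_div_iff₀ hpos]
      simp only [Kind.speed, Kind.speedDeriv]
      rw [abs_of_nonneg (a := 2 * (_ + _)) (by positivity), ← abs_two, ← abs_mul, abs_lt, abs_two]
      constructor <;> linarith
    · rw [div_lt_iff₀ hpos]
      simp only [Kind.speed, Kind.speedDeriv]
      rw [abs_of_nonneg (a := (_ + _)) (by positivity), abs_lt]
      constructor <;> linarith
    · rw [div_eq_iff hpos.ne']
      simp only [Kind.speed, Kind.speedDeriv, abs_mul, abs_two]

theorem Kind.speed_ne_zero {s : Kind} {r : ℝ} (hr : s = Kind.plus → r ≠ 0) : s.speed r ≠ 0 := by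
  have hc := Real.cosh_pos r
  cases s
  · have : Real.sinh r ≠ 0 := by simpa using hr rfl
    simp only [Kind.speed]; positivity
  · simp only [Kind.speed]; positivity
  · simp only [Kind.speed, Real.cosh_add_sinh]; positivity

end Frames

/-! ### The one-parameter group acting on frames, and its differential. -/

section Flow

variable {n : ℕ}

/-- The generator stands on the right so that the velocity of u g_t is the generator evaluated at
the moved frame u g_t. -/
theorem hasDerivAt_flowMat (s : Kind) (t : ℝ) (i j : Fin 2) :
    HasDerivAt (fun t => flowMat s t i j) ((flowMat s t * genMat s) i j) t := by
  have h0 : HasDerivAt (fun t : ℝ => (t : ℂ)) 1 t := Complex.ofRealCLM.hasDerivAt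
  have hI := h0.mul_const Complex.I
  cases s <;> fin_cases i <;> fin_cases j <;>
    simp [flowMat, genMat, Matrix.mul_apply, Fin.sum_univ_two]
  · simpa using hI.cexp
  · exact hasDerivAt_const _ _
  · exact hasDerivAt_const _ _
  · simpa using hI.neg.cexp
  · exact (Complex.hasDerivAt_cosh t).comp_ofReal
  · exact (Complex.hasDerivAt_sinh t).comp_ofReal
  · exact (Complex.hasDerivAt_sinh t).comp_ofReal
  · exact (Complex.hasDerivAt_cosh t).comp_ofReal
  -- For type 0 the generator X is nilpotent, X² = 0, so g_t X = X is constant in t.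
  · refine hI.congr_deriv ?_
    linear_combination -(t : ℂ) * Complex.I_sq
  · exact h0.congr_deriv (by ring)
  · exact h0.congr_deriv (by ring)
  · refine (hI.const_sub 1).congr_deriv ?_
    linear_combination -(t : ℂ) * Complex.I_sq

theorem contDiff_flowMat (s : Kind) (i j : Fin 2) :
    ContDiff ℝ ∞ (fun t => flowMat s t i j) := by
  have h0 : ContDiff ℝ ∞ (fun t : ℝ => (t : ℂ)) := Complex.ofRealCLM.contDiff
  have hc : ContDiff ℝ ∞ Complex.cosh := Complex.contDiff_cosh.restrict_scalars ℝ
  have hs : ContDiff ℝ ∞ Complex.sinh := Complex.contDiff_sinh.restrict_scalars ℝ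
  cases s <;> fin_cases i <;> fin_cases j <;> simp [flowMat]
  · exact (h0.mul contDiff_const).cexp
  · exact contDiff_const
  · exact contDiff_const
  · exact (h0.mul contDiff_const).neg.cexp
  · exact hc.comp h0
  · exact hs.comp h0
  · exact hs.comp h0
  · exact hc.comp h0
  · exact contDiff_const.add (h0.mul contDiff_const)
  · exact h0
  · exact h0
  · exact contDiff_const.sub (h0.mul contDiff_const)

theorem genMat_mul_flowMat (s : Kind) (t : ℝ) :
    genMat s * flowMat s t = flowMat s t * genMat s := by
  cases s <;> ext i j <;> fin_cases i <;> fin_cases j <;>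
    simp [flowMat, genMat, Matrix.mul_apply, Fin.sum_univ_two] <;> ring_nf

theorem rmul_mul (v : V n × V n) (g g' : Matrix (Fin 2) (Fin 2) ℂ) :
    rmul v (g * g') = rmul (rmul v g) g' := by
  simp only [rmul, Matrix.mul_apply, Fin.sum_univ_two]
  ext1 <;> simp only <;> module

/-- The right multiplication by a matrix as a continuous linear map. -/
def rmulL (g : Matrix (Fin 2) (Fin 2) ℂ) : V n × V n →L[ℝ] V n × V n :=
  (comb (g 0 0) (g 1 0)).prod (comb (g 0 1) (g 1 1))

theorem rmulL_apply (g : Matrix (Fin 2) (Fin 2) ℂ) (v : V n × V n) : rmulL g v = rmul v g := rfl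

theorem hasDerivAt_rmul_flowMat (s : Kind) (t : ℝ) (v : V n × V n) :
    HasDerivAt (fun t => rmul v (flowMat s t)) (rmul (rmul v (flowMat s t)) (genMat s)) t := by
  rw [← rmul_mul]
  exact (((hasDerivAt_flowMat s t 0 0).smul_const v.1).add
    ((hasDerivAt_flowMat s t 1 0).smul_const v.2)).prodMk
    (((hasDerivAt_flowMat s t 0 1).smul_const v.1).add
    ((hasDerivAt_flowMat s t 1 1).smul_const v.2))

theorem contDiff_rmul_flowMat (s : Kind) :
    ContDiff ℝ ∞ (fun a : ℝ × (V n × V n) => rmul a.2 (flowMat s a.1)) := by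
  have h : ∀ i j, ContDiff ℝ ∞ (fun a : ℝ × (V n × V n) => flowMat s a.1 i j) :=
    fun i j => (contDiff_flowMat s i j).comp contDiff_fst
  exact (((h 0 0).smul contDiff_snd.fst).add ((h 1 0).smul contDiff_snd.snd)).prodMk
    (((h 0 1).smul contDiff_snd.fst).add ((h 1 1).smul contDiff_snd.snd))

/-- Right multiplication only changes the basis of the plane span{u₋, u₊}, so its orthogonal
complement is unchanged. -/
theorem rmul_mem_horSpace (s : Kind) (t : ℝ) (u : Stiefel n) {h : V n × V n}
    (hh : h ∈ horSpace u) : rmul h (flowMat s t) ∈ horSpace (Stiefel.flow s t u) := by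
  obtain ⟨h1, h2, h3, h4⟩ := hh
  change _ ∧ _ ∧ _ ∧ _
  simp only [Stiefel.flow, rmul, herm_add_left, herm_add_right, herm_smul_left, herm_smul_right,
    h1, h2, h3, h4]
  simp

/-- The circle direction is scalar and commutes with every matrix; the generator commutes with its
own flow. -/
theorem rmul_mem_orbitTangent (s : Kind) (t : ℝ) (u : Stiefel n) {k : V n × V n}
    (hk : k ∈ orbitTangent s u) : rmul k (flowMat s t) ∈ orbitTangent s (Stiefel.flow s t u) := by
  rw [orbitTangent, Submodule.mem_span_pair] at hk ⊢
  obtain ⟨a, b, rfl⟩ := hk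
  refine ⟨a, b, ?_⟩
  rw [← rmulL_apply (flowMat s t), map_add, map_smul, map_smul, rmulL_apply, rmulL_apply, ← rmul_mul,
    genMat_mul_flowMat, rmul_mul]
  congr 2
  change (Complex.I • (rmul u.1 (flowMat s t)).1, Complex.I • (rmul u.1 (flowMat s t)).2) = _
  simp only [rmul, smul_add, smul_comm Complex.I]

variable {E H M : Type*} [NormedAddCommGroup E] [NormedSpace ℝ E] [TopologicalSpace H]
  {I : ModelWithCorners ℝ E H} [TopologicalSpace M] [ChartedSpace H M]

theorem contMDiff_flow (s : Kind) {u : M → Stiefel n}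
    (hu : ContMDiff I 𝓘(ℝ, V n × V n) ∞ (fun p => (u p).1)) :
    ContMDiff (𝓘(ℝ, ℝ).prod I) 𝓘(ℝ, V n × V n) ∞
      (fun m : ℝ × M => (Stiefel.flow s m.1 (u m.2)).1) :=
  (contDiff_rmul_flowMat s).contMDiff.comp
    (contMDiff_fst.prodMk_space (hu.comp contMDiff_snd))

/-- Horizontality is assumed for the lift u only. This formula, with the two invariance lemmas
above, transports it to all frames u g_t. -/
theorem mfderiv_flow (s : Kind) {u : M → Stiefel n}
    (hu : ContMDiff I 𝓘(ℝ, V n × V n) ∞ (fun p => (u p).1)) (m : ℝ × M)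
    (X : TangentSpace (𝓘(ℝ, ℝ).prod I) m) :
    mfderiv (𝓘(ℝ, ℝ).prod I) 𝓘(ℝ, V n × V n)
      (fun m : ℝ × M => (Stiefel.flow s m.1 (u m.2)).1) m X =
      (X.1 : ℝ) • rmul (Stiefel.flow s m.1 (u m.2)).1 (genMat s) +
      rmul (mfderiv I 𝓘(ℝ, V n × V n) (fun p => (u p).1) m.2 X.2) (flowMat s m.1) := by
  refine (mfderiv_prod_eq_add_apply ((contMDiff_flow s hu).mdifferentiable (by simp) m)).trans ?_
  congr 1
  · have h := hasDerivAt_rmul_flowMat s m.1 (u m.2).1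
    have h' := congrArg (fun L : ℝ →L[ℝ] V n × V n => L X.1)
      (mfderiv_eq_fderiv (f := fun t => rmul (u m.2).1 (flowMat s t)) (x := m.1))
    rw [h.hasFDerivAt.fderiv] at h'
    exact h'
  · have h := mfderiv_normedSpace_comp_apply (I := I) (G := rmulL (flowMat s m.1))
      (rmulL (flowMat s m.1)).differentiableAt (hu.mdifferentiable (by simp) m.2) X.2
    rw [ContinuousLinearMap.fderiv] at h
    exact h

end Flow

/-! ### Differential, normal and connection in a local trivialization. -/

section LocalGeometry

variable {n : ℕ} {E H M : Type*} [NormedAddCommGroup E] [NormedSpace ℝ E] [TopologicalSpace H]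
  {I : ModelWithCorners ℝ E H} [TopologicalSpace M] [ChartedSpace H M]

theorem D_comb (a b : ℂ) {F : M → V n × V n} {x : M} (hF : MDifferentiableAt I 𝓘(ℝ, V n × V n) F x)
    (X : TangentSpace I x) :
    D I (fun y => comb a b (F y)) x X = comb a b (mfderiv I 𝓘(ℝ, V n × V n) F x X) := by
  have h := mfderiv_normedSpace_comp_apply (G := comb a b) (comb a b).differentiableAt hF X
  rw [ContinuousLinearMap.fderiv] at h
  exact h

/-- The point and the unit normal along the flow, `(t, p) ↦ (w, ν)`. -/
def flowPair (s : Kind) (r : ℝ) (u : M → Stiefel n) (m : ℝ × M) : HorPair n :=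
  normalPair s r (Stiefel.flow s m.1 (u m.2))

theorem contMDiff_flowPair (s : Kind) (r : ℝ) {u : M → Stiefel n}
    (hu : ContMDiff I 𝓘(ℝ, V n × V n) ∞ (fun p => (u p).1)) :
    ContMDiff (𝓘(ℝ, ℝ).prod I) 𝓘(ℝ, V n × V n) ∞ (fun m => (flowPair s r u m).1) :=
  ((comb _ _).contDiff.comp_contMDiff (contMDiff_flow s hu)).prodMk_space
    ((comb _ _).contDiff.comp_contMDiff (contMDiff_flow s hu))

theorem D_flowPair_fst (s : Kind) (r : ℝ) {u : M → Stiefel n}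
    (hu : ContMDiff I 𝓘(ℝ, V n × V n) ∞ (fun p => (u p).1)) (m : ℝ × M)
    (X : TangentSpace (𝓘(ℝ, ℝ).prod I) m) :
    D (𝓘(ℝ, ℝ).prod I) (fun m => (flowPair s r u m).1.1) m X =
      comb (Complex.cosh r) (s.factor * Complex.sinh r)
        (mfderiv (𝓘(ℝ, ℝ).prod I) 𝓘(ℝ, V n × V n)
          (fun m : ℝ × M => (Stiefel.flow s m.1 (u m.2)).1) m X) :=
  D_comb _ _ ((contMDiff_flow s hu).mdifferentiable (by simp) m) X

theorem D_flowPair_snd (s : Kind) (r : ℝ) {u : M → Stiefel n}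
    (hu : ContMDiff I 𝓘(ℝ, V n × V n) ∞ (fun p => (u p).1)) (m : ℝ × M)
    (X : TangentSpace (𝓘(ℝ, ℝ).prod I) m) :
    D (𝓘(ℝ, ℝ).prod I) (fun m => (flowPair s r u m).1.2) m X =
      comb (Complex.sinh r) (s.factor * Complex.cosh r)
        (mfderiv (𝓘(ℝ, ℝ).prod I) 𝓘(ℝ, V n × V n)
          (fun m : ℝ × M => (Stiefel.flow s m.1 (u m.2)).1) m X) :=
  D_comb _ _ ((contMDiff_flow s hu).mdifferentiable (by simp) m) X

/-- The derivative of the flow in the direction of the flow parameter. -/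
theorem mfderiv_flow_fst (s : Kind) {u : M → Stiefel n}
    (hu : ContMDiff I 𝓘(ℝ, V n × V n) ∞ (fun p => (u p).1)) (m : ℝ × M) (a : ℝ) :
    mfderiv (𝓘(ℝ, ℝ).prod I) 𝓘(ℝ, V n × V n)
      (fun m : ℝ × M => (Stiefel.flow s m.1 (u m.2)).1) m
        ((a, 0) : ℝ × E) = a • rmul (Stiefel.flow s m.1 (u m.2)).1 (genMat s) := by
  refine (mfderiv_flow s hu m ((a, 0) : ℝ × E)).trans ?_
  have h : mfderiv I 𝓘(ℝ, V n × V n) (fun p => (u p).1) m.2 (0 : E) = 0 := map_zero _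
  have h' : rmul (0 : V n × V n) (flowMat s m.1) = 0 := map_zero (rmulL (flowMat s m.1))
  exact (congrArg (a • rmul (Stiefel.flow s m.1 (u m.2)).1 (genMat s) + ·)
    ((congrArg (rmul · (flowMat s m.1)) h).trans h')).trans (add_zero _)

theorem diffLift_flowPair_fst (s : Kind) (r : ℝ) {u : M → Stiefel n}
    (hu : ContMDiff I 𝓘(ℝ, V n × V n) ∞ (fun p => (u p).1)) (m : ℝ × M) (a : ℝ) :
    diffLift (𝓘(ℝ, ℝ).prod I) (fun m => (flowPair s r u m).1.1) m ((a, 0) : ℝ × E) =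
      (-(a * s.speed r : ℝ) : ℂ) • Complex.I • (flowPair s r u m).1.2 := by
  have h := D_flowPair_fst s r hu m ((a, 0) : ℝ × E)
  rw [mfderiv_flow_fst s hu, map_smul] at h
  rw [← Complex.coe_smul] at h
  refine (congrArg (hor _) h).trans ((hor_smul _ _ _).trans ?_)
  refine (congrArg ((a : ℂ) • ·) (hor_gen s r _)).trans ?_
  rw [smul_smul]
  push_cast
  rw [mul_neg]
  rfl

theorem covLift_flowPair_fst (s : Kind) (r : ℝ) {u : M → Stiefel n}
    (hu : ContMDiff I 𝓘(ℝ, V n × V n) ∞ (fun p => (u p).1)) (m : ℝ × M) (a : ℝ) :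
    covLift (𝓘(ℝ, ℝ).prod I) (fun m => (flowPair s r u m).1.1)
      (fun m => (flowPair s r u m).1.2) m ((a, 0) : ℝ × E) =
      (-(a * s.speedDeriv r : ℝ) : ℂ) • Complex.I • (flowPair s r u m).1.2 := by
  have h := D_flowPair_fst s r hu m ((a, 0) : ℝ × E)
  have h' := D_flowPair_snd s r hu m ((a, 0) : ℝ × E)
  rw [mfderiv_flow_fst s hu, map_smul, ← Complex.coe_smul] at h h'
  have hsp : ∀ x y : V n, (sp ((a : ℂ) • x) y : ℂ) = a * sp x y := by
    intro x y; rw [sp, herm_smul_left, Complex.re_ofReal_mul, Complex.ofReal_mul, sp]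
  refine (congrArg₂ (fun x y : V n => hor _ (x + (sp y _ : ℂ) • _)) h' h).trans ?_
  rw [hsp, mul_smul, ← smul_add, hor_smul]
  refine (congrArg ((a : ℂ) • ·) (hor_gen_normal s r _)).trans ?_
  rw [smul_smul]
  push_cast
  rw [mul_neg]
  rfl

/-- The image of the differential is orthogonal to the normal. -/
theorem sp_diffLift_flowPair (s : Kind) (r : ℝ) {u : M → Stiefel n}
    (hu : ContMDiff I 𝓘(ℝ, V n × V n) ∞ (fun p => (u p).1))
    (hhor : ∀ (p : M) (X : TangentSpace I p), ∃ h ∈ horSpace (u p), ∃ k ∈ orbitTangent s (u p),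
      mfderiv I 𝓘(ℝ, V n × V n) (fun q => (u q).1) p X = h + k)
    (m : ℝ × M) (X : TangentSpace (𝓘(ℝ, ℝ).prod I) m) :
    sp (diffLift (𝓘(ℝ, ℝ).prod I) (fun m => (flowPair s r u m).1.1) m X)
      (flowPair s r u m).1.2 = 0 := by
  obtain ⟨h, hh, k, hk, hX⟩ := hhor m.2 X.2
  have hh' := rmul_mem_horSpace s m.1 _ hh
  have hk' := rmul_mem_orbitTangent s m.1 _ hk
  set v := Stiefel.flow s m.1 (u m.2) with hv
  set h' := rmul h (flowMat s m.1)
  obtain ⟨a, b, hab⟩ := Submodule.mem_span_pair.1 hk'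
  have hD := D_flowPair_fst s r hu m X
  have e : rmul (h + k) (flowMat s m.1) =
      h' + (a • (Complex.I • v.1.1, Complex.I • v.1.2) + b • rmul v.1 (genMat s)) := by
    rw [hab, ← rmulL_apply, map_add]; rfl
  have e' : comb (Complex.cosh r) (s.factor * Complex.sinh r)
      (Complex.I • v.1.1, Complex.I • v.1.2) = Complex.I • (normalPair s r v).1.1 := by
    rw [normalPair_fst]; simp only [comb_apply]; module
  rw [mfderiv_flow s hu, hX, ← hv, e, map_add, map_add, map_add, map_smul, map_smul, map_smul, e',
    ← Complex.coe_smul, ← Complex.coe_smul, ← Complex.coe_smul] at hD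
  have hw := (normalPair s r v).2.2
  have hw' : herm (normalPair s r v).1.1 (normalPair s r v).1.2 = 0 := by
    rw [← star_herm, hw, star_zero]
  have hgen := hor_gen s r v
  have hperp : herm (comb (Complex.cosh r) (s.factor * Complex.sinh r) h')
      (normalPair s r v).1.2 = 0 := by
    obtain ⟨h1, h2, h3, h4⟩ := hh'
    rw [normalPair_snd]
    simp only [comb_apply, herm_add_left, herm_add_right, herm_smul_left, herm_smul_right,
      h1, h2, h3, h4]
    ring
  have hone := herm_normal s r v
  change sp (hor (normalPair s r v).1.1 _) (normalPair s r v).1.2 = 0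
  rw [hD]
  -- The i w term is vertical and drops out; the generator leaves a real multiple of iν, whose real
  -- product with ν is zero; the remaining part is Hermitian-orthogonal to ν.
  simp only [hor_add, hor_smul, hgen, hor_self _ (normalPair s r v).2.1, smul_zero, zero_add]
  simp only [sp, hor, herm_add_left, herm_smul_left, hperp, hw', hone]
  simp

theorem contDiff_comb_param (s : Kind) (r : ℝ) :
    ContDiff ℝ ∞ (fun a : ℝ × (V n × V n) => comb (Complex.cosh (r + a.1 : ℝ))
      (s.factor * Complex.sinh (r + a.1 : ℝ)) a.2) := by
  have h0 : ContDiff ℝ ∞ (fun a : ℝ × (V n × V n) => ((r + a.1 : ℝ) : ℂ)) :=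
    Complex.ofRealCLM.contDiff.comp (contDiff_const.add contDiff_fst)
  have hc := (Complex.contDiff_cosh.restrict_scalars ℝ).comp h0
  have hs := (Complex.contDiff_sinh.restrict_scalars ℝ).comp h0
  exact (hc.smul contDiff_snd.fst).add ((contDiff_const.mul hs).smul contDiff_snd.snd)

theorem hasDerivAt_comb_param (s : Kind) (r τ : ℝ) (v : V n × V n) :
    HasDerivAt (fun τ : ℝ => comb (Complex.cosh (r + τ : ℝ))
      (s.factor * Complex.sinh (r + τ : ℝ)) v)
      (comb (Complex.sinh (r + τ : ℝ)) (s.factor * Complex.cosh (r + τ : ℝ)) v) τ := by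
  have hc := (Complex.hasDerivAt_cosh (r + τ : ℝ)).comp_ofReal.comp_const_add r τ
  have hs := (Complex.hasDerivAt_sinh (r + τ : ℝ)).comp_ofReal.comp_const_add r τ
  exact (hc.smul_const v.1).add ((hs.const_mul s.factor).smul_const v.2)

theorem contMDiff_flowPair_param (s : Kind) (r : ℝ) {u : M → Stiefel n}
    (hu : ContMDiff I 𝓘(ℝ, V n × V n) ∞ (fun p => (u p).1)) :
    ContMDiff (𝓘(ℝ, ℝ).prod (𝓘(ℝ, ℝ).prod I)) 𝓘(ℝ, V n) ∞
      (fun a : ℝ × (ℝ × M) => (flowPair s (r + a.1) u a.2).1.1) :=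
  (contDiff_comb_param s r).comp_contMDiff
    (f := fun a : ℝ × (ℝ × M) => (a.1, (Stiefel.flow s a.2.1 (u a.2.2)).1))
    (contMDiff_fst.prodMk_space ((contMDiff_flow s hu).comp contMDiff_snd))

/-- The map `(τ, m) ↦ w_{r + τ}(m)` has the derivative `ν` in the direction of `τ`. -/
theorem diffLift_flowPair_param (s : Kind) (r τ : ℝ) {u : M → Stiefel n}
    (hu : ContMDiff I 𝓘(ℝ, V n × V n) ∞ (fun p => (u p).1)) (m : ℝ × M)
    (X : TangentSpace (𝓘(ℝ, ℝ).prod (𝓘(ℝ, ℝ).prod I)) (τ, m)) :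
    diffLift (𝓘(ℝ, ℝ).prod (𝓘(ℝ, ℝ).prod I))
      (fun a : ℝ × (ℝ × M) => (flowPair s (r + a.1) u a.2).1.1) (τ, m) X =
      ((X.1 : ℝ) : ℂ) • (flowPair s (r + τ) u m).1.2 +
        diffLift (𝓘(ℝ, ℝ).prod I) (fun m => (flowPair s (r + τ) u m).1.1) m X.2 := by
  have h1 := mfderiv_prod_eq_add_apply (v := X)
    ((contMDiff_flowPair_param s r hu).mdifferentiable (by simp) (τ, m))
  have h2 := congrArg (fun L : ℝ →L[ℝ] V n => L X.1)
    (mfderiv_eq_fderiv (f := fun τ : ℝ => (flowPair s (r + τ) u m).1.1) (x := τ))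
  have h3 : HasDerivAt (fun τ : ℝ => (flowPair s (r + τ) u m).1.1)
    (flowPair s (r + τ) u m).1.2 τ :=
    hasDerivAt_comb_param s r τ (Stiefel.flow s m.1 (u m.2)).1
  rw [h3.hasFDerivAt.fderiv] at h2
  have h4 : D (𝓘(ℝ, ℝ).prod (𝓘(ℝ, ℝ).prod I))
      (fun a : ℝ × (ℝ × M) => (flowPair s (r + a.1) u a.2).1.1) (τ, m) X =
      (X.1 : ℝ) • (flowPair s (r + τ) u m).1.2 +
        D (𝓘(ℝ, ℝ).prod I) (fun m => (flowPair s (r + τ) u m).1.1) m X.2 :=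
    h1.trans (congrArg (· + _) h2)
  rw [diffLift, h4, hor_add, ← Complex.coe_smul, hor_smul]
  congr 2
  have h5 : herm (flowPair s (r + τ) u m).1.2 (flowPair s (r + τ) u m).1.1 = 0 :=
    (flowPair s (r + τ) u m).2.2
  simp [hor, h5]

end LocalGeometry

/-! ### The statements on Σ_S. -/

section Global

variable {n : ℕ} {S : Type*} {s : Kind} {φ : S → MZ s n}

/-- The unit normal field along `Φ_r^s`. -/
def normalField (φ : S → MZ s n) (r : ℝ) (y : PullS φ) : TCH n := normalMap s r y.1.2

theorem normalField_base (r : ℝ) (y : PullS φ) : (normalField φ r y).base = Phi φ r y :=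
  normalMap_base s r _

/-- The lift satisfies w' = ν and ν' = w. As w' is horizontal, ⟨w', iw⟩ = 0 and the correction in
`covLift` vanishes; what remains is the horizontal part of w, which is zero. -/
theorem isGeodesic_Phi (y : PullS φ) :
    IsGeodesic (fun r => Phi φ r y) (fun r => normalField φ r y) := by
  refine ⟨fun r => normalField_base r y, fun r => ?_⟩
  obtain ⟨u, hu⟩ := Quotient.exists_rep y.1.2
  have hw : ∀ t, HasDerivAt (fun t => (normalPair s t u).1.1) (normalPair s t u).1.2 t := by
    intro t
    have h := hasDerivAt_comb_param s 0 t u.1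
    simp only [zero_add] at h
    exact h
  have hν : ∀ t, HasDerivAt (fun t => (normalPair s t u).1.2) (normalPair s t u).1.1 t := by
    intro t
    exact ((Complex.hasDerivAt_sinh t).comp_ofReal.smul_const u.1.1).add
      (((Complex.hasDerivAt_cosh t).comp_ofReal.const_mul s.factor).smul_const u.1.2)
  have hν0 := (normalPair s r u).2.2
  have hw0 : herm (normalPair s r u).1.2 (Complex.I • (normalPair s r u).1.1) = 0 := by
    rw [herm_smul_right, hν0, mul_zero]
  have e1 := (D_eq_fderiv (fun t => (normalPair s t u).1.1) r (1 : ℝ)).trans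
    ((fderiv_apply_one_eq_deriv).trans (hw r).deriv)
  have e2 := (D_eq_fderiv (fun t => (normalPair s t u).1.2) r (1 : ℝ)).trans
    ((fderiv_apply_one_eq_deriv).trans (hν r).deriv)
  refine ⟨fun t => normalPair s t u, Filter.Eventually.of_forall fun t => ⟨?_, ?_⟩, ?_, ?_⟩
  · have h0 : ContDiff ℝ ∞ (fun t : ℝ => (t : ℂ)) := Complex.ofRealCLM.contDiff
    have hc := (Complex.contDiff_cosh.restrict_scalars ℝ (n := ∞)).comp h0
    have hs := (Complex.contDiff_sinh.restrict_scalars ℝ (n := ∞)).comp h0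
    have h : ContDiff ℝ ∞ (fun t => (normalPair s t u).1) :=
      ((hc.smul contDiff_const).add ((contDiff_const.mul hs).smul contDiff_const)).prodMk
        ((hs.smul contDiff_const).add ((contDiff_const.mul hc).smul contDiff_const))
    exact h.contMDiff t
  · exact congrArg (normalMap s t) hu
  · refine (congrArg (hor _) e1).trans ?_
    simp [hor, hν0]
  · refine (congrArg₂ (fun x y : V n => hor _ (x + (sp y _ : ℂ) • _)) e2 e1).trans ?_
    rw [sp, hw0]
    simp [hor_self _ (normalPair s r u).2.1]

variable {E H : Type*} [NormedAddCommGroup E] [NormedSpace ℝ E] [TopologicalSpace H]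
  {I : ModelWithCorners ℝ E H} [TopologicalSpace S] [ChartedSpace H S]
  {U : TopologicalSpace.Opens S} {u : U → Stiefel n}

theorem isFieldLiftNear_flowPair (r : ℝ) (hu : IsLocalLift I φ U u) (m : ℝ × U) :
    IsFieldLiftNear (𝓘(ℝ, ℝ).prod I) (fun m' => normalField φ r (triv hu m'))
      (flowPair s r u) m :=
  Filter.Eventually.of_forall fun m' => ⟨contMDiff_flowPair s r hu.smooth m', rfl⟩

theorem isLiftNear_flowPair (r : ℝ) (hu : IsLocalLift I φ U u) (m : ℝ × U) :
    IsLiftNear (𝓘(ℝ, ℝ).prod I) (fun m' => Phi φ r (triv hu m'))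
      (fun m' => (flowPair s r u m').base) m :=
  Filter.Eventually.of_forall fun m' =>
    ⟨(contDiff_fst.comp_contMDiff (contMDiff_flowPair s r hu.smooth)) m', rfl⟩

theorem isLiftNear_flowPair_param (r : ℝ) (hu : IsLocalLift I φ U u) (a : ℝ × (ℝ × U)) :
    IsLiftNear (𝓘(ℝ, ℝ).prod (𝓘(ℝ, ℝ).prod I))
      (fun a : ℝ × (ℝ × U) => Phi φ (r + a.1) (triv hu a.2))
      (fun a => (flowPair s (r + a.1) u a.2).base) a :=
  Filter.Eventually.of_forall fun a' => ⟨contMDiff_flowPair_param s r hu.smooth a', rfl⟩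

theorem isUnitNormalAt_normalField (hhor : IsHorizontal I φ) (r : ℝ) (y : PullS φ) :
    PullS.IsUnitNormalAt I (Phi φ r) (normalField φ r) y := by
  intro U u hu m _
  refine ⟨Filter.Eventually.of_forall fun m' => normalField_base r _, flowPair s r u,
    isFieldLiftNear_flowPair r hu m, ?_, sp_diffLift_flowPair s r hu.smooth (hhor U u hu) m⟩
  rw [sp, flowPair, herm_normal, Complex.one_re]

theorem isHopfAt_normalField (hhor : IsHorizontal I φ) {r μ : ℝ} (h0 : s.speed r ≠ 0)
    (hμ : s.speedDeriv r = -μ * s.speed r) {y : PullS φ}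
    (hy : PullS.IsImmersionAt I (Phi φ r) y) :
    PullS.IsHopfAt I (Phi φ r) (normalField φ r) μ y := by
  refine ⟨hy, isUnitNormalAt_normalField hhor r y, fun U u hu m _ => ?_⟩
  -- Since ∂_t maps to -λ iν, the vector ∂_t/λ represents ξ = -iν.
  refine ⟨flowPair s r u, isFieldLiftNear_flowPair r hu m, (((s.speed r)⁻¹, 0) : ℝ × E), ?_, ?_⟩
  · rw [diffLift_flowPair_fst s r hu.smooth, inv_mul_cancel₀ h0]
    simp
  · rw [diffLift_flowPair_fst s r hu.smooth, covLift_flowPair_fst s r hu.smooth,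
      inv_mul_cancel₀ h0, hμ, mul_comm, mul_assoc, mul_inv_cancel₀ h0]
    simp

/-- At an immersed point the generator of the flow is not mapped to zero. -/
theorem speed_ne_zero_of_isImmersionAt (hφ : IsTwistorImmersion I φ) {r : ℝ} {y : PullS φ}
    (hy : PullS.IsImmersionAt I (Phi φ r) y) : s.speed r ≠ 0 := by
  intro h0
  obtain ⟨U, u, hyU, hu⟩ := hφ.smooth y.1.1
  -- The lift and y lie over the same point of M_Z^s, so a flow time t brings y into the
  -- trivialization. If λ = 0, the nonzero vector ∂_t there is killed by the differential.
  obtain ⟨t, ht⟩ := Quotient.exact ((hu.lift ⟨y.1.1, hyU⟩).trans y.2)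
  have h := (isImmersionAtCH_iff (isLiftNear_flowPair r hu (t, ⟨y.1.1, hyU⟩))).1
    (hy U u hu (t, ⟨y.1.1, hyU⟩) (Subtype.ext (Prod.ext rfl ht)))
  have h1 := h ((1, 0) : ℝ × E) ((diffLift_flowPair_fst s r hu.smooth _ 1).trans (by simp [h0]))
  exact one_ne_zero (congrArg Prod.fst (show ((1, 0) : ℝ × E) = 0 from h1))

/-- The extra parameter adds the direction ν, which is a unit vector orthogonal to the image of dΦ
and so never creates or removes a kernel. -/
theorem isImmersionAtCH_param_iff (hhor : IsHorizontal I φ) (r τ : ℝ) (hu : IsLocalLift I φ U u)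
    (m : ℝ × U) :
    IsImmersionAtCH (𝓘(ℝ, ℝ).prod (𝓘(ℝ, ℝ).prod I))
      (fun a : ℝ × (ℝ × U) => Phi φ (r + a.1) (triv hu a.2)) (τ, m) ↔
    IsImmersionAtCH (𝓘(ℝ, ℝ).prod I) (fun m' => Phi φ (r + τ) (triv hu m')) m := by
  rw [isImmersionAtCH_iff (isLiftNear_flowPair_param r hu (τ, m)),
    isImmersionAtCH_iff (isLiftNear_flowPair (r + τ) hu m)]
  constructor
  · intro h X hX
    have h1 := h ((0, X) : ℝ × (ℝ × E)) ((diffLift_flowPair_param s r τ hu.smooth m _).trans (by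
      refine (congrArg (_ + ·) hX).trans ?_
      simp))
    exact congrArg Prod.snd (show ((0, X) : ℝ × (ℝ × E)) = 0 from h1)
  · intro h X hX
    have h1 := (diffLift_flowPair_param s r τ hu.smooth m X).symm.trans hX
    have h2 := sp_diffLift_flowPair s (r + τ) hu.smooth (hhor U u hu) m X.2
    -- Pairing aν + dΦ(X) = 0 with ν isolates a = 0.
    have h3 := congrArg (fun v => (herm v (flowPair s (r + τ) u m).1.2).re) h1
    have h4 : herm (flowPair s (r + τ) u m).1.2 (flowPair s (r + τ) u m).1.2 = 1 :=
      herm_normal s _ _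
    have h5 : herm (0 : V n) (flowPair s (r + τ) u m).1.2 = 0 := by simp [herm]
    simp only [herm_add_left, herm_smul_left, h4, h5, Complex.add_re] at h3
    rw [sp] at h2
    have h6 : (X.1 : ℝ) = 0 := by simpa [h2] using h3
    rw [h6, Complex.ofReal_zero, zero_smul, zero_add] at h1
    exact Prod.ext h6 (h X.2 h1)

end Global

end HopfTwistor

end

theorem mainTheorem1 (n : ℕ) (hn : 2 ≤ n) (s : Kind)
    {S : Type*} [TopologicalSpace S] [ChartedSpace (EuclideanSpace ℝ (Fin (2 * n - 2))) S]
    [IsManifold (𝓡 (2 * n - 2)) ∞ S]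
    (φ : S → MZ s n) (hφ : IsTwistorImmersion (𝓡 (2 * n - 2)) φ)
    (hhor : IsHorizontal (𝓡 (2 * n - 2)) φ)
    (r : ℝ) (hr : s = Kind.plus → r ≠ 0)
    (hΦ : ∀ y : PullS φ, PullS.IsImmersionAt (𝓡 (2 * n - 2)) (Phi φ r) y) :
    ∃ N : ℝ → PullS φ → TCH n,
      (∃ μ : ℝ, s.HopfBound μ ∧
        ∀ y, PullS.IsHopfAt (𝓡 (2 * n - 2)) (Phi φ r) (N r) μ y) ∧
      (∀ y, IsGeodesic (fun r' => Phi φ r' y) (fun r' => N r' y)) ∧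
      (∀ r' y, PullS.IsUnitNormalAt (𝓡 (2 * n - 2)) (Phi φ r') (N r') y) ∧
      (∀ r', ∃ μ : ℝ, s.HopfBound μ ∧
        ∀ y, PullS.IsImmersionAt (𝓡 (2 * n - 2)) (Phi φ r') y →
          PullS.IsHopfAt (𝓡 (2 * n - 2)) (Phi φ r') (N r') μ y) ∧
      (∀ r' y, ¬ PullS.IsImmersionAt (𝓡 (2 * n - 2)) (Phi φ r') y ↔
        PullS.IsCriticalAt (𝓡 (2 * n - 2)) (fun τ => Phi φ (r + τ)) (r' - r) y) := by
  refine ⟨normalField φ, ?_, isGeodesic_Phi, isUnitNormalAt_normalField hhor, fun r' => ?_,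
    fun r' y => ?_⟩
  · obtain ⟨μ, hμ, h⟩ := s.exists_hopfCurvature r
    have h0 := Kind.speed_ne_zero hr
    exact ⟨μ, hμ, fun y => isHopfAt_normalField hhor h0 (h h0) (hΦ y)⟩
  -- At r' = 0 for type + there is no immersed point and μ is arbitrary; elsewhere an immersed point
  -- itself forces λ ≠ 0.
  · obtain ⟨μ, hμ, h⟩ := s.exists_hopfCurvature r'
    refine ⟨μ, hμ, fun y hy => ?_⟩
    have h0 := speed_ne_zero_of_isImmersionAt hφ hy
    exact isHopfAt_normalField hhor h0 (h h0) hy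
  -- Both sides quantify over the same trivializations around y, so they are compared one
  -- trivialization at a time.
  · refine not_congr (forall_congr' fun U => forall_congr' fun u => forall_congr' fun hu =>
      forall_congr' fun m => imp_congr_right fun _ => ?_)
    rw [isImmersionAtCH_param_iff hhor r (r' - r) hu m, add_sub_cancel]
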